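/- Let $H$ be a real Hilbert space, identified with its dual. For a set-valued operator $T\colon H\rightrightarrows H$ put $\operatorname{gra}T=\{(x,u): u\in Tx\}$, $\operatorname{dom}T=\{x: Tx\neq\varnothing\}$, let $T^{-1}$ be the inverse relation, and let $T^*$ be the adjoint: $u\in T^*x$ iff $\langle u,y\rangle=\langle x,v\rangle$ for all $(y,v)\in\operatorname{gra}T$. $T$ is a linear relation if $\operatorname{gra}T$ is a linear subspace of $H\times H$. A linear relation $T$ is skew if $\langle x,u\rangle=0$ for all $(x,u)\in\operatorname{gra}T$, and symmetric if $\operatorname{gra}T\subseteq\operatorname{gra}T^*$. $T$ is monotone if $\langle x-y,u-v\rangle\ge 0$ for all $(x,u),(y,v)\in\operatorname{gra}T$, and maximal monotone if it is monotone and no proper enlargement of its graph is monotone. Sums of operators are pointwise Minkowski sums. $\mathbb I_C$ is the operator equal to $\{0\}$ on $C$ and $\varnothing$ off $C$. Below, $f$ always denotes a proper lower semicontinuous convex function $H\to\,]-\infty,+\infty]$ with subdifferential operator $\partial f$. $T$ is Borwein–Wiersma decomposable if $T=\partial f+R$ for some $f$ and some skew, at most single-valued linear relation $R$. $T$ is irreducible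 if, whenever $T=\partial f+R$ with $R$ monotone, the set $\bigcup_{x\in\operatorname{dom}T}\partial f(x)$ is a singleton. $T$ is Asplund decomposable if $T=\partial f+R$ for some $f$ and some monotone irreducible $R$. On $\ell^2$, let $S$ be the operator $Sy=\big(\tfrac12y_n+\sum_{i<n}y_i\big)_{n\ge1}$ with $\operatorname{dom}S=\{y\in\ell^2:\sum_{i\ge1}y_i=0,\ (\sum_{i\le n}y_i)_n\in\ell^2\}$ (infinite sums of real numbers are limits of partial sums). On $L^2[0,1]$, let $V$ be the Volterra operator $(Vx)(t)=\int_0^tx$ and let $A=V^{-1}$. (a) Each of $S$, $S^*$, $A$, $A^*$ is an at most single-valued linear relation, is maximal monotone, irreducible and Asplund decomposable, and does not have full domain. (b) $S$ is Borwein–Wiersma decomposable, while $S^*$, $A$ and $A^*$ are not. $V=A^{-1}$ and $V^*=(A^*)^{-1}$ are Borwein–Wiersma decomposable. (c) $S^*y=\big(\tfrac12y_n+\sum_{i>n}y_i\big)_n$ with $\operatorname{dom}S^*=\{y\in\ell^2: \sum_i y_i \text{ converges},\ (\sum_{i>n}y_i)_n\in\ell^2\}$. $S$ is skew and $S^*$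 is not skew. $\operatorname{dom}S$ is dense in $\ell^2$, $\operatorname{dom}S\subsetneq\operatorname{dom}S^*$, and $S^*=-S$ on $\operatorname{dom}S$. (d) $V$ and $V^*$ are everywhere defined and single-valued, and $(V^*x)(t)=\int_t^1x$. $\operatorname{dom}A$ consists of the $x\in L^2[0,1]$ that are absolutely continuous (have an absolutely continuous representative) with $x(0)=0$ and $x'\in L^2[0,1]$, and $Ax=x'$. $\operatorname{dom}A^*$ consists of those that are absolutely continuous with $x(1)=0$ and $x'\in L^2[0,1]$, and $A^*x=-x'$. Neither $A$ nor $A^*$ is symmetric, and neither is skew. $\operatorname{dom}A\not\subseteq\operatorname{dom}A^*$ and $\operatorname{dom}A^*\not\subseteq\operatorname{dom}A$. The set $Y=\operatorname{dom}A\cap\operatorname{dom}A^*$ is dense in $L^2[0,1]$, and $A+\mathbb I_Y$ and $A^*+\mathbb I_Y$ are skew. -/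

import Mathlib

open MeasureTheory Filter Topology
open scoped ENNReal

/-- A set-valued operator `A : H ⇉ H` on a real Hilbert space `H` (identified with its dual). -/
abbrev SetOp (H : Type*) := H → Set H

namespace SetOp

section Basic

variable {H : Type*} [NormedAddCommGroup H] [InnerProductSpace ℝ H]

/-- The graph `{(x, u) | u ∈ A x}`. -/
def graph (A : SetOp H) : Set (H × H) := {p | p.2 ∈ A p.1}

/-- The domain `{x | A x ≠ ∅}`. -/
def dom (A : SetOp H) : Set H := {x | (A x).Nonempty}

/-- The inverse operator. -/
def inverse (A : SetOp H) : SetOp H := fun u => {x | u ∈ A x}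

/-- The pointwise (Minkowski) sum of two set-valued operators. -/
def sum (A B : SetOp H) : SetOp H := fun x => {w | ∃ u ∈ A x, ∃ v ∈ B x, w = u + v}

/-- The indicator mapping of `C`: `{0}` on `C`, empty elsewhere. -/
def indicatorMap (C : Set H) : SetOp H := fun x => {u | x ∈ C ∧ u = 0}

/-- The adjoint: `(x, u)` lies in its graph iff `(u, -x)` is orthogonal to the graph of `A`. -/
def adjoint (A : SetOp H) : SetOp H :=
  fun x => {u | ∀ y v, v ∈ A y → inner ℝ u y + inner ℝ (-x) v = 0}

def AtMostSingleValued (A : SetOp H) : Prop := ∀ x, (A x).Subsingleton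

/-- The graph is a linear subspace of `H × H`. -/
def IsLinearRelation (A : SetOp H) : Prop :=
  ∃ M : Submodule ℝ (H × H), (M : Set (H × H)) = A.graph

/-- A skew linear relation. -/
def IsSkew (A : SetOp H) : Prop :=
  A.IsLinearRelation ∧ ∀ x u, u ∈ A x → inner ℝ x u = 0

/-- A symmetric linear relation: its graph is contained in that of its adjoint. -/
def IsSymmetric (A : SetOp H) : Prop :=
  A.IsLinearRelation ∧ A.graph ⊆ A.adjoint.graph

def IsMonotone (A : SetOp H) : Prop :=
  ∀ x u y v, u ∈ A x → v ∈ A y → 0 ≤ inner ℝ (x - y) (u - v)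

/-- Monotone, with no proper monotone enlargement of the graph. -/
def IsMaximalMonotone (A : SetOp H) : Prop :=
  A.IsMonotone ∧ ∀ B : SetOp H, B.IsMonotone → A.graph ⊆ B.graph → A.graph = B.graph

/-- `f : H → ]-∞, +∞]` is proper, lower semicontinuous and convex. -/
def IsProperLscConvex (f : H → EReal) : Prop :=
  (∀ x, f x ≠ ⊥) ∧ (∃ x, f x ≠ ⊤) ∧ LowerSemicontinuous f ∧
    ∀ x y : H, ∀ a b : ℝ, 0 < a → 0 < b → a + b = 1 →
      f (a • x + b • y) ≤ (a : EReal) * f x + (b : EReal) * f y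

/-- The subdifferential operator of `f`. -/
def subdifferential (f : H → EReal) : SetOp H :=
  fun x => {u | ∀ y, ((inner ℝ (y - x) u : ℝ) : EReal) + f x ≤ f y}

/-- `A = ∂f + S` with `f` proper lsc convex, `S` skew and at most single-valued. -/
def IsBorweinWiersmaDecomposable (A : SetOp H) : Prop :=
  ∃ (f : H → EReal) (S : SetOp H), IsProperLscConvex f ∧ S.IsSkew ∧ S.AtMostSingleValued ∧
    A = (subdifferential f).sum S

/-- Whenever `A = ∂f + S` with `f` proper lsc convex and `S` monotone, the range of `∂f`
restricted to `dom A` is a singleton. -/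
def IsIrreducible (A : SetOp H) : Prop :=
  ∀ (f : H → EReal) (S : SetOp H), IsProperLscConvex f → S.IsMonotone →
    A = (subdifferential f).sum S → ∃ c : H, (⋃ x ∈ A.dom, subdifferential f x) = {c}

/-- `A = ∂f + S` with `f` proper lsc convex and `S` monotone and irreducible. -/
def IsAsplundDecomposable (A : SetOp H) : Prop :=
  ∃ (f : H → EReal) (S : SetOp H), IsProperLscConvex f ∧ S.IsMonotone ∧ S.IsIrreducible ∧
    A = (subdifferential f).sum S

end Basic

end SetOp

/-- The real Hilbert space `ℓ²`, with sequences indexed from `0`. -/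
abbrev SeqL2 := lp (fun _ : ℕ => ℝ) 2

/-- `y ↦ (y_n / 2 + ∑_{i<n} y_i)_n`, defined for those `y ∈ ℓ²` whose partial sums
`∑_{i≤n} y_i` tend to `0` and form a sequence in `ℓ²`. -/
def skewSum : SetOp SeqL2 := fun y =>
  {z | Tendsto (fun N => ∑ i ∈ Finset.range N, y i) atTop (𝓝 0) ∧
    Memℓp (fun n : ℕ => ∑ i ∈ Finset.range (n + 1), y i) 2 ∧
    ∀ n, z n = (1 / 2) * y n + ∑ i ∈ Finset.range n, y i}

/-- `t_n = ∑_{i>n} y_i` for every `n`, as convergent (not necessarily absolutely convergent)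
series. -/
def IsTailSum (y t : ℕ → ℝ) : Prop :=
  ∀ n, Tendsto (fun N => ∑ i ∈ Finset.Ioc n N, y i) atTop (𝓝 (t n))

/-- Lebesgue measure on `[0,1]`. -/
noncomputable abbrev volume01 : Measure ℝ := volume.restrict (Set.Icc 0 1)

/-- The real Hilbert space `L²[0,1]`. -/
noncomputable abbrev L201 := Lp ℝ 2 volume01

/-- The Volterra integration operator `(V x)(t) = ∫₀ᵗ x`, as an operator with graph in
`L²[0,1] × L²[0,1]`. -/
def volterra : SetOp L201 := fun x =>
  {y | (y : ℝ → ℝ) =ᵐ[volume01] fun t => ∫ s in (0 : ℝ)..t, x s}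

/-- The inverse Volterra operator. -/
def inverseVolterra : SetOp L201 := volterra.inverse

/-- `x ∈ L²[0,1]` has the absolutely continuous representative `g`. -/
def HasACRep (x : L201) (g : ℝ → ℝ) : Prop :=
  AbsolutelyContinuousOnInterval g 0 1 ∧ (x : ℝ → ℝ) =ᵐ[volume01] g

/-! Everything rests on one criterion, `isIrreducible_of_dense`. Suppose `T` is a single-valued
linear relation whose quadratic form `⟨x, Tx⟩` vanishes on a dense subspace `E` of the domain. If `T
= ∂f + R` with `R` monotone, then for `d` in `E` the monotonicity of `R` says that `∂f` cannot
increase in the direction `d`, whereas convexity says that it cannot decrease. This squeezes `f`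
between affine functions and leaves only one subgradient. On the other hand, `IsIrreducible.isSkew`
shows that an irreducible linear relation can be Borwein–Wiersma decomposable only if it is skew. So
each negative claim reduces to one vector with nonzero quadratic form.

On `ℓ²`, the operator is `½(I + R)(I - R)⁻¹` with `R` the right shift, and its adjoint is the same
expression in the left shift. `R` is an isometry, so the first is skew. The left shift is a
contraction that kills the first basis vector, so the adjoint is monotone but not skew. The two are
opposite on the dense range of `I - R`.

On `L²[0,1]`, integration by parts gives `V + V* = 1 ⊗ 1`, so `⟨Vx, x⟩ = ½⟨1, x⟩²`. With the
injectivity of `V` and the fact that no `Vx` equals `1`, this is all that is used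
(`IsPrimitivePair`), and these properties are symmetric in `V` and `V*`. The inverses are skew
exactly on `V(1^⊥)`, which is dense and is the intersection of their domains. `V` itself splits as
the gradient of `¼⟨1, x⟩²` plus a skew part. -/

namespace SetOp

/-! ### Linear relations, decompositions and the irreducibility criterion. -/

section General

variable {H : Type*} [NormedAddCommGroup H] [InnerProductSpace ℝ H]

local notation "⟪" x ", " y "⟫" => inner ℝ x y

namespace IsLinearRelation

variable {T : SetOp H}

lemma zero_mem (hT : T.IsLinearRelation) : (0 : H) ∈ T 0 := by
  obtain ⟨M, hM⟩ := hT
  have : ((0 : H), (0 : H)) ∈ (M : Set (H × H)) := M.zero_mem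
  rwa [hM] at this

lemma add_mem (hT : T.IsLinearRelation) {x y u v : H} (hu : u ∈ T x) (hv : v ∈ T y) :
    u + v ∈ T (x + y) := by
  obtain ⟨M, hM⟩ := hT
  have h1 : (x, u) ∈ (M : Set (H × H)) := by rw [hM]; exact hu
  have h2 : (y, v) ∈ (M : Set (H × H)) := by rw [hM]; exact hv
  have : (x, u) + (y, v) ∈ (M : Set (H × H)) := M.add_mem h1 h2
  rwa [hM] at this

lemma smul_mem (hT : T.IsLinearRelation) {x u : H} (c : ℝ) (hu : u ∈ T x) :
    c • u ∈ T (c • x) := by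
  obtain ⟨M, hM⟩ := hT
  have h1 : (x, u) ∈ (M : Set (H × H)) := by rw [hM]; exact hu
  have : c • (x, u) ∈ (M : Set (H × H)) := M.smul_mem c h1
  rwa [hM] at this

lemma sub_mem (hT : T.IsLinearRelation) {x y u v : H} (hu : u ∈ T x) (hv : v ∈ T y) :
    u - v ∈ T (x - y) := by
  have := hT.add_mem hu (hT.smul_mem (-1) hv)
  simpa [sub_eq_add_neg] using this

lemma isMonotone (hT : T.IsLinearRelation) (h : ∀ x u, u ∈ T x → 0 ≤ ⟪x, u⟫) :
    T.IsMonotone :=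
  fun _ _ _ _ hu hv => h _ _ (hT.sub_mem hu hv)

end IsLinearRelation

lemma isMaximalMonotone_of_forall {T : SetOp H} (hT : T.IsMonotone)
    (h : ∀ a b, (∀ x u, u ∈ T x → 0 ≤ ⟪x - a, u - b⟫) → b ∈ T a) :
    T.IsMaximalMonotone := by
  refine ⟨hT, fun B hB hTB => Set.Subset.antisymm hTB ?_⟩
  rintro ⟨a, b⟩ hab
  exact h a b fun x u hu => hB x u a b (hTB (show (x, u) ∈ T.graph from hu)) hab

/-- The relation with graph `{(P s, Q s)}`. -/
def ofParam {G : Type*} [AddCommGroup G] [Module ℝ G] (P Q : G →ₗ[ℝ] H) : SetOp H :=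
  fun x => {u | ∃ s, P s = x ∧ Q s = u}

section OfParam

variable {G : Type*} [AddCommGroup G] [Module ℝ G] {P Q : G →ₗ[ℝ] H}

lemma mem_ofParam {x u : H} : u ∈ ofParam P Q x ↔ ∃ s, P s = x ∧ Q s = u := Iff.rfl

lemma isLinearRelation_ofParam : (ofParam P Q).IsLinearRelation := by
  refine ⟨LinearMap.range (P.prod Q), ?_⟩
  ext ⟨x, u⟩
  simp [graph, mem_ofParam]

lemma atMostSingleValued_ofParam (hP : ∀ s, P s = 0 → s = 0) :
    (ofParam P Q).AtMostSingleValued := by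
  rintro x _ ⟨s, hs, rfl⟩ _ ⟨t, ht, rfl⟩
  have : s - t = 0 := hP _ (by rw [map_sub, hs, ht, sub_self])
  rw [sub_eq_zero.1 this]

lemma dom_ofParam : (ofParam P Q).dom = Set.range P := by
  ext x
  constructor
  · rintro ⟨_, s, hs, -⟩
    exact ⟨s, hs⟩
  · rintro ⟨s, hs⟩
    exact ⟨Q s, s, hs, rfl⟩

lemma mem_adjoint_ofParam {x u : H} :
    u ∈ (ofParam P Q).adjoint x ↔ ∀ s, ⟪u, P s⟫ = ⟪x, Q s⟫ := by
  constructor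
  · intro h s
    have := h (P s) (Q s) ⟨s, rfl, rfl⟩
    rw [inner_neg_left] at this
    linarith
  · rintro h _ _ ⟨s, rfl, rfl⟩
    rw [inner_neg_left, h s]
    ring

end OfParam

lemma isProperLscConvex_coe {φ : H → ℝ} (hc : Continuous φ) (hφ : ConvexOn ℝ Set.univ φ) :
    IsProperLscConvex (fun x => (φ x : EReal)) := by
  refine ⟨fun x => EReal.coe_ne_bot _, ⟨0, EReal.coe_ne_top _⟩,
    (continuous_coe_real_ereal.comp hc).lowerSemicontinuous, fun x y a b ha hb hab => ?_⟩
  have := hφ.2 (Set.mem_univ x) (Set.mem_univ y) ha.le hb.le hab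
  simp only [smul_eq_mul] at this
  beta_reduce
  exact_mod_cast this

lemma mem_subdifferential_coe {φ : H → ℝ} {x u : H} :
    u ∈ subdifferential (fun x => (φ x : EReal)) x ↔ ∀ y, ⟪y - x, u⟫ + φ x ≤ φ y := by
  refine forall_congr' fun y => ?_
  beta_reduce
  norm_cast

lemma subdifferential_zero (x : H) :
    subdifferential (fun _ : H => ((0 : ℝ) : EReal)) x = {0} := by
  ext u
  rw [mem_subdifferential_coe (φ := fun _ => 0), Set.mem_singleton_iff]
  constructor
  · intro h
    have := h (x + u)
    rw [add_sub_cancel_left, add_zero] at this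
    exact inner_self_eq_zero.1 (this.antisymm real_inner_self_nonneg)
  · rintro rfl y
    simp

/-- The choice `f = 0` makes irreducible monotone operators Asplund decomposable and single-valued
skew relations Borwein–Wiersma decomposable. -/
lemma sum_subdifferential_zero (T : SetOp H) :
    (subdifferential (fun _ : H => ((0 : ℝ) : EReal))).sum T = T := by
  funext x
  ext w
  simp only [sum, subdifferential_zero]
  simp

lemma isProperLscConvex_zero : IsProperLscConvex (fun _ : H => ((0 : ℝ) : EReal)) :=
  isProperLscConvex_coe continuous_const (convexOn_const 0 convex_univ)

lemma IsIrreducible.isAsplundDecomposable {T : SetOp H} (hT : T.IsIrreducible)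
    (hm : T.IsMonotone) : T.IsAsplundDecomposable :=
  ⟨_, T, isProperLscConvex_zero, hm, hT, (sum_subdifferential_zero T).symm⟩

lemma IsSkew.isBorweinWiersmaDecomposable {T : SetOp H} (hT : T.IsSkew)
    (hs : T.AtMostSingleValued) : T.IsBorweinWiersmaDecomposable :=
  ⟨_, T, isProperLscConvex_zero, hT, hs, (sum_subdifferential_zero T).symm⟩

lemma IsSkew.isMonotone {T : SetOp H} (hT : T.IsSkew) : T.IsMonotone :=
  hT.1.isMonotone fun x u hu => (hT.2 x u hu).ge

/-- An irreducible linear relation is Borwein–Wiersma decomposable only if it is skew. -/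
lemma IsIrreducible.isSkew {T : SetOp H} (hT : T.IsIrreducible) (hl : T.IsLinearRelation)
    (h : T.IsBorweinWiersmaDecomposable) : T.IsSkew := by
  obtain ⟨f, S, hf, hS, hSs, hsum⟩ := h
  obtain ⟨c, hc⟩ := hT f S hf hS.isMonotone hsum
  have key : ∀ x u, u ∈ T x → ∃ v ∈ S x, u = c + v := by
    intro x u hu
    have hx : x ∈ T.dom := ⟨u, hu⟩
    rw [hsum] at hu
    obtain ⟨w, hw, v, hv, rfl⟩ := hu
    have : w ∈ ⋃ x ∈ T.dom, subdifferential f x := Set.mem_iUnion₂.2 ⟨x, hx, hw⟩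
    rw [hc] at this
    exact ⟨v, hv, by rw [Set.mem_singleton_iff.1 this]⟩
  -- At the origin `0 = c + v` with `v ∈ S 0 = {0}`, so the constant subgradient vanishes.
  have hc0 : c = 0 := by
    obtain ⟨v, hv, h0⟩ := key 0 0 hl.zero_mem
    rw [hSs 0 hv hS.1.zero_mem, add_zero] at h0
    exact h0.symm
  refine ⟨hl, fun x u hu => ?_⟩
  obtain ⟨v, hv, rfl⟩ := key x u hu
  rw [hc0, zero_add]
  exact hS.2 x v hv

lemma ne_top_of_mem_subdifferential {f : H → EReal} (hf : IsProperLscConvex f) {x u : H}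
    (hu : u ∈ subdifferential f x) : f x ≠ ⊤ := by
  intro hx
  obtain ⟨y, hy⟩ := hf.2.1
  have := hu y
  rw [hx, EReal.coe_add_top, top_le_iff] at this
  exact hy this

/-- A proper `f` is finite wherever it has a subgradient, so `toReal` loses nothing here. -/
lemma inner_add_toReal_le {f : H → EReal} (hf : IsProperLscConvex f) {x u y v : H}
    (hu : u ∈ subdifferential f x) (hv : v ∈ subdifferential f y) :
    ⟪y - x, u⟫ + (f x).toReal ≤ (f y).toReal := by
  have := hu y
  rw [← EReal.coe_toReal (ne_top_of_mem_subdifferential hf hu) (hf.1 x),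
    ← EReal.coe_toReal (ne_top_of_mem_subdifferential hf hv) (hf.1 y)] at this
  exact_mod_cast this

lemma eq_zero_of_forall_le_mul {a c : ℝ} (h : ∀ t : ℝ, c ≤ t * a) : a = 0 := by
  by_contra ha
  have := h ((c - 1) / a)
  rw [div_mul_cancel₀ _ ha] at this
  linarith

/-- A single-valued linear relation which is skew on a dense subspace of its domain is
irreducible. -/
lemma isIrreducible_of_dense {T : SetOp H} (hl : T.IsLinearRelation)
    (hs : T.AtMostSingleValued) (E : Submodule ℝ H) (hE : Dense (E : Set H))
    (h0 : ∀ x ∈ E, ∃ u ∈ T x, ⟪x, u⟫ = 0) : T.IsIrreducible := by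
  intro f S hf hS hsum
  have hdec : ∀ x ∈ T.dom, ∃ u ∈ subdifferential f x, ∃ v ∈ S x, u + v ∈ T x := by
    rintro x ⟨w, hw⟩
    have hw' := hw
    rw [hsum] at hw'
    obtain ⟨u, hu, v, hv, rfl⟩ := hw'
    exact ⟨u, hu, v, hv, hw⟩
  have hmem : ∀ x u v, u ∈ subdifferential f x → v ∈ S x → u + v ∈ T x := by
    intro x u v hu hv
    rw [hsum]
    exact ⟨u, hu, v, hv, rfl⟩
  -- Single-valuedness of `T` turns the increment of `S` along `d` into `u - u' + w` with `w ∈ T d`.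
  -- Pairing with `d` removes `w`, and monotonicity of `S` leaves the inequality.
  have hle : ∀ d ∈ E, ∀ y ∈ T.dom, ∀ u ∈ subdifferential f y,
      ∃ u' ∈ subdifferential f (y + d), ⟪d, u'⟫ ≤ ⟪d, u⟫ := by
    intro d hd y hy u hu
    obtain ⟨w, hw, hdw⟩ := h0 d hd
    obtain ⟨-, -, v, hv, -⟩ := hdec y hy
    have hyT := hmem y u v hu hv
    have hydT := hl.add_mem hyT hw
    obtain ⟨u', hu', v', hv', huv'⟩ := hdec (y + d) ⟨_, hydT⟩
    have heq : u' + v' = u + v + w := hs _ huv' hydT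
    have hm := hS (y + d) v' y v hv' hv
    rw [add_sub_cancel_left, show v' - v = u - u' + w by
      rw [eq_sub_of_add_eq' heq]; abel, inner_add_right, hdw, inner_sub_right] at hm
    exact ⟨u', hu', by linarith⟩
  have heq : ∀ x ∈ T.dom, ∀ y ∈ T.dom, ∀ u ∈ subdifferential f x, ∀ v ∈ subdifferential f y,
      v = u := by
    intro x hx y hy u hu v hv
    -- On `y + E`, `f` lies below an affine function of slope `v` by `hle` and above one of slope
    -- `u`. A linear form on `E` that is bounded below is zero, so density of `E` gives `v = u`.
    have hbound : ∀ d ∈ E, (f x).toReal - (f y).toReal + ⟪y - x, u⟫ ≤ ⟪d, v - u⟫ := by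
      intro d hd
      obtain ⟨v', hv', hvv⟩ := hle d hd y hy v hv
      have h1 := inner_add_toReal_le hf hv' hv
      have h2 := inner_add_toReal_le hf hu hv'
      rw [show y - (y + d) = -d by abel, inner_neg_left] at h1
      rw [show y + d - x = (y - x) + d by abel, inner_add_left] at h2
      rw [inner_sub_right]
      linarith
    refine sub_eq_zero.1 (hE.eq_zero_of_inner_right (𝕜 := ℝ) fun d hd => ?_)
    refine eq_zero_of_forall_le_mul (c := (f x).toReal - (f y).toReal + ⟪y - x, u⟫) fun t => ?_
    have := hbound _ (E.smul_mem t hd)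
    rwa [real_inner_smul_left] at this
  have hd0 : (0 : H) ∈ T.dom := ⟨0, hl.zero_mem⟩
  obtain ⟨c, hc, -⟩ := hdec 0 hd0
  refine ⟨c, Set.Subset.antisymm (fun w hw => ?_) ?_⟩
  · obtain ⟨x, hx, hw⟩ := Set.mem_iUnion₂.1 hw
    exact heq 0 hd0 x hx c hc w hw
  · rintro _ rfl
    exact Set.mem_iUnion₂.2 ⟨0, hd0, hc⟩

end General

/-! ### Monotone relations given by their Cayley transform. -/

section Cayley

variable {H : Type*} [NormedAddCommGroup H] [InnerProductSpace ℝ H]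

local notation "⟪" x ", " y "⟫" => inner ℝ x y

/-- The relation with Cayley transform `C`. -/
noncomputable def ofCayley (C : H →ₗ[ℝ] H) : SetOp H :=
  ofParam (LinearMap.id - C) ((1 / 2 : ℝ) • (LinearMap.id + C))

variable {C D : H →ₗ[ℝ] H}

lemma mem_ofCayley {x u : H} :
    u ∈ ofCayley C x ↔ ∃ s, s - C s = x ∧ (1 / 2 : ℝ) • (s + C s) = u := by
  simp [ofCayley, mem_ofParam]

/-- The quadratic form is nonnegative when `C` is a contraction and zero when `C` is an isometry. -/
lemma inner_ofCayley (s : H) :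
    ⟪s - C s, (1 / 2 : ℝ) • (s + C s)⟫ = (1 / 2) * (‖s‖ ^ 2 - ‖C s‖ ^ 2) := by
  rw [real_inner_smul_right, inner_add_right, inner_sub_left, inner_sub_left,
    real_inner_self_eq_norm_sq, real_inner_self_eq_norm_sq, real_inner_comm s (C s)]
  ring

lemma isMaximalMonotone_ofCayley (hC : ∀ s, ‖C s‖ ≤ ‖s‖) :
    (ofCayley C).IsMaximalMonotone := by
  refine isMaximalMonotone_of_forall (isLinearRelation_ofParam.isMonotone ?_) ?_
  · intro x u hu
    obtain ⟨s, rfl, rfl⟩ := mem_ofCayley.1 hu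
    rw [inner_ofCayley]
    have := pow_le_pow_left₀ (norm_nonneg _) (hC s) 2
    linarith
  -- This is Minty's argument: a graph point `(x, u)` has parameter `s = ½x + u`. Choosing the one
  -- with the same `½x + u` as `(a, b)` gives `u - b = -½(x - a)`, so being monotonically related
  -- forces equality.
  · intro a b h
    set s : H := (1 / 2 : ℝ) • a + b with hs
    have h1 := h _ _ (mem_ofCayley.2 ⟨s, rfl, rfl⟩)
    have h2 : (1 / 2 : ℝ) • (s + C s) - b = (-(1 / 2) : ℝ) • (s - C s - a) := by
      have : b = s - (1 / 2 : ℝ) • a := by rw [hs]; abel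
      rw [this]
      module
    rw [h2, real_inner_smul_right] at h1
    have h3 : s - C s - a = 0 := inner_self_eq_zero (𝕜 := ℝ).1
      (le_antisymm (by linarith) real_inner_self_nonneg)
    rw [h3, smul_zero] at h2
    exact mem_ofCayley.2 ⟨s, sub_eq_zero.1 h3, sub_eq_zero.1 h2⟩

lemma adjoint_ofCayley (hCD : ∀ x y, ⟪C x, y⟫ = ⟪x, D y⟫) :
    (ofCayley C).adjoint = ofCayley D := by
  have hDC : ∀ x y, ⟪D x, y⟫ = ⟪x, C y⟫ := fun x y => by
    rw [real_inner_comm, ← hCD, real_inner_comm]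
  funext x
  ext u
  rw [mem_ofCayley, ofCayley, mem_adjoint_ofParam]
  -- Moving `C` across the inner product turns the family of conditions into the vanishing of a
  -- single vector, tested against itself.
  have hiff : (∀ s, ⟪u, (LinearMap.id - C : H →ₗ[ℝ] H) s⟫ =
      ⟪x, ((1 / 2 : ℝ) • (LinearMap.id + C) : H →ₗ[ℝ] H) s⟫) ↔
      u - D u = (1 / 2 : ℝ) • (x + D x) := by
    rw [← sub_eq_zero, ← inner_self_eq_zero (𝕜 := ℝ)]
    have hexp : ∀ s, ⟪u, (LinearMap.id - C : H →ₗ[ℝ] H) s⟫ -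
        ⟪x, ((1 / 2 : ℝ) • (LinearMap.id + C) : H →ₗ[ℝ] H) s⟫ =
        ⟪u - D u - (1 / 2 : ℝ) • (x + D x), s⟫ := by
      intro s
      simp only [LinearMap.sub_apply, LinearMap.id_apply, LinearMap.smul_apply,
        LinearMap.add_apply, inner_sub_left, inner_sub_right, inner_add_left, inner_add_right,
        real_inner_smul_left, real_inner_smul_right, hDC]
    constructor
    · intro h
      rw [← hexp, sub_eq_zero]
      exact h _
    · intro h s
      rw [← sub_eq_zero, hexp, inner_self_eq_zero.1 h, inner_zero_left]
  rw [hiff]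
  constructor
  · intro h
    refine ⟨u + (1 / 2 : ℝ) • x, ?_, ?_⟩
    · rw [map_add, map_smul]
      linear_combination (norm := module) h
    · rw [map_add, map_smul]
      linear_combination (norm := module) (-(1 / 2 : ℝ)) • h
  · rintro ⟨s, rfl, rfl⟩
    rw [map_sub, map_smul, map_add]
    module

end Cayley

/-! ### Pairs of adjoint operators whose sum has rank one. -/

section PrimitivePair

variable {H : Type*} [NormedAddCommGroup H] [InnerProductSpace ℝ H]

local notation "⟪" x ", " y "⟫" => inner ℝ x y

/-- `V` and `W` are adjoint to each other, `V + W = e ⊗ e`, `V` is injective and `e` does not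
lie in its range. -/
structure IsPrimitivePair (e : H) (V W : H →ₗ[ℝ] H) : Prop where
  inner_left : ∀ x y, ⟪V x, y⟫ = ⟪x, W y⟫
  add_eq : ∀ x, V x + W x = ⟪e, x⟫ • e
  injective : ∀ x, V x = 0 → x = 0
  ne : ∀ x, V x ≠ e

namespace IsPrimitivePair

variable {e : H} {V W : H →ₗ[ℝ] H}

lemma inner_self (h : IsPrimitivePair e V W) (x : H) : ⟪V x, x⟫ = (1 / 2) * ⟪e, x⟫ ^ 2 := by
  have h1 := congrArg (fun z => ⟪z, x⟫) (h.add_eq x)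
  simp only [inner_add_left, real_inner_smul_left] at h1
  rw [real_inner_comm x (W x), ← h.inner_left] at h1
  linarith

lemma eq_zero_of_eq_smul (h : IsPrimitivePair e V W) {x : H} {c : ℝ} (hx : V x = c • e) :
    c = 0 ∧ x = 0 := by
  have hc : c = 0 := by
    by_contra hc
    refine h.ne (c⁻¹ • x) ?_
    rw [map_smul, hx, inv_smul_smul₀ hc]
  exact ⟨hc, h.injective x (by rw [hx, hc, zero_smul])⟩

/-- If `W x` is `0` or `e`, then `V x` is a multiple of `e`, which forces `x = 0` and the multiple
to be `0`. By this symmetry each result on `V` also serves for `W`. -/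
protected lemma symm (h : IsPrimitivePair e V W) : IsPrimitivePair e W V where
  inner_left x y := by rw [real_inner_comm, ← h.inner_left, real_inner_comm]
  add_eq x := by rw [add_comm, h.add_eq]
  injective x hx := by
    have := h.add_eq x
    rw [hx, add_zero] at this
    exact (h.eq_zero_of_eq_smul this).2
  ne x hx := by
    have := h.add_eq x
    rw [hx] at this
    have h2 : V x = (⟪e, x⟫ - 1) • e := by
      rw [sub_smul, one_smul, ← this, add_sub_cancel_right]
    obtain ⟨h3, rfl⟩ := h.eq_zero_of_eq_smul h2
    rw [inner_zero_right] at h3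
    norm_num at h3

lemma inner_self_pos (h : IsPrimitivePair e V W) : 0 < ⟪e, e⟫ := by
  refine real_inner_self_pos.2 fun he => h.ne 0 ?_
  rw [map_zero, he]

/-- `V(u + w) = (V + W)w` is a multiple of `e`. Together with `eq_neg` this identifies the common
range of `V` and `W` with `V(e^⊥)`. -/
lemma add_eq_zero (h : IsPrimitivePair e V W) {u w : H} (huw : V u = W w) :
    u + w = 0 ∧ ⟪e, u⟫ = 0 := by
  have h1 : V (u + w) = ⟪e, w⟫ • e := by rw [map_add, huw, add_comm, h.add_eq]
  obtain ⟨h2, h3⟩ := h.eq_zero_of_eq_smul h1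
  refine ⟨h3, ?_⟩
  rw [eq_neg_of_add_eq_zero_left h3, inner_neg_right, h2, neg_zero]

lemma eq_neg (h : IsPrimitivePair e V W) {u : H} (hu : ⟪e, u⟫ = 0) : V u = W (-u) := by
  have := h.add_eq u
  rw [hu, zero_smul] at this
  rw [map_neg, eq_neg_of_add_eq_zero_left this]

/-- The inverse of `V`. -/
noncomputable abbrev inv (V : H →ₗ[ℝ] H) : SetOp H := ofParam V LinearMap.id

lemma mem_inv {x u : H} : u ∈ inv V x ↔ V u = x := by simp [mem_ofParam]

lemma adjoint_inv (h : IsPrimitivePair e V W) : (inv V).adjoint = inv W := by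
  funext x
  ext u
  rw [mem_adjoint_ofParam, mem_inv]
  simp only [LinearMap.id_apply]
  constructor
  · intro hx
    refine ext_inner_right ℝ fun s => ?_
    rw [h.symm.inner_left, hx]
  · rintro rfl s
    rw [h.symm.inner_left]

lemma isMaximalMonotone_inv (h : IsPrimitivePair e V W) : (inv V).IsMaximalMonotone := by
  have hpos : ∀ x, 0 ≤ ⟪V x, x⟫ := fun x => by rw [h.inner_self]; positivity
  refine isMaximalMonotone_of_forall (isLinearRelation_ofParam.isMonotone ?_) fun a b hab => ?_
  · rintro _ u ⟨u, rfl, rfl⟩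
    exact hpos u
  · rw [mem_inv, ← sub_eq_zero, ← inner_self_eq_zero (𝕜 := ℝ)]
    set z := V b - a
    -- The graph point over `b + t • z` is compared with `(a, b)`. For small negative `t` the linear
    -- term would dominate unless `z = 0`.
    have key : ∀ t : ℝ, 0 ≤ t * ⟪z, z⟫ + t ^ 2 * ⟪V z, z⟫ := by
      intro t
      have := hab (V (b + t • z)) (b + t • z) (mem_inv.2 rfl)
      rw [map_add, map_smul, add_sub_cancel_left,
        show V b + t • V z - a = z + t • V z by simp only [z]; abel, inner_add_left,
        real_inner_smul_right, real_inner_smul_left, real_inner_smul_right] at this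
      linarith
    have h1 := hpos z
    have h2 : 0 ≤ ⟪z, z⟫ := real_inner_self_nonneg
    by_contra hne
    have h3 : 0 < ⟪z, z⟫ := lt_of_le_of_ne h2 (Ne.symm hne)
    -- The `+ 1` keeps the denominator positive even if `⟪V z, z⟫ = 0`.
    have := key (-(⟪z, z⟫ / (⟪V z, z⟫ + 1)))
    have h4 : -(⟪z, z⟫ / (⟪V z, z⟫ + 1)) * ⟪z, z⟫ + (-(⟪z, z⟫ / (⟪V z, z⟫ + 1))) ^ 2 * ⟪V z, z⟫
        = -(⟪z, z⟫ ^ 2 / (⟪V z, z⟫ + 1) ^ 2) := by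
      field_simp
      ring
    rw [h4] at this
    have h5 : 0 < ⟪z, z⟫ ^ 2 / (⟪V z, z⟫ + 1) ^ 2 := by positivity
    linarith

/-- The intersection of the ranges of `V` and `W`. -/
noncomputable def core (e : H) (V : H →ₗ[ℝ] H) : Submodule ℝ H :=
  (LinearMap.ker (innerₛₗ ℝ e)).map V

lemma mem_core {x : H} : x ∈ core e V ↔ ∃ u, ⟪e, u⟫ = 0 ∧ V u = x := by
  simp [core]

lemma adjoint_ofParam_id (h : IsPrimitivePair e V W) :
    (ofParam LinearMap.id V).adjoint = ofParam LinearMap.id W := by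
  funext x
  ext u
  rw [mem_adjoint_ofParam]
  simp only [mem_ofParam, LinearMap.id_apply, exists_eq_left]
  constructor
  · intro hx
    refine ext_inner_right ℝ fun s => ?_
    rw [hx, h.symm.inner_left]
  · rintro rfl s
    rw [h.symm.inner_left]

/-- If `z` is orthogonal to `V(e^⊥)`, then `W z` is orthogonal to `e^⊥`, hence a multiple of `e`,
hence `z = 0`. -/
lemma dense_core [CompleteSpace H] (h : IsPrimitivePair e V W) :
    Dense (core e V : Set H) := by
  rw [Submodule.dense_iff_topologicalClosure_eq_top, Submodule.topologicalClosure_eq_top_iff,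
    Submodule.eq_bot_iff]
  intro z hz
  rw [Submodule.mem_orthogonal] at hz
  have hWz : ∀ u, ⟪e, u⟫ = 0 → ⟪u, W z⟫ = 0 := fun u hu => by
    rw [← h.inner_left]
    exact hz _ (mem_core.2 ⟨u, hu, rfl⟩)
  have he := h.inner_self_pos
  have hu : ⟪e, W z - (⟪e, W z⟫ / ⟪e, e⟫) • e⟫ = 0 := by
    rw [inner_sub_right, real_inner_smul_right, div_mul_cancel₀ _ he.ne', sub_self]
  have h0 : W z - (⟪e, W z⟫ / ⟪e, e⟫) • e = 0 := by
    have h1 := hWz _ hu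
    rw [← inner_self_eq_zero (𝕜 := ℝ)]
    set w := W z - (⟪e, W z⟫ / ⟪e, e⟫) • e with hw
    have h2 : ⟪w, w⟫ = ⟪w, W z⟫ - (⟪e, W z⟫ / ⟪e, e⟫) * ⟪w, e⟫ := by
      rw [← real_inner_smul_right, ← inner_sub_right]
    rw [h2, h1, real_inner_comm e w, hu, mul_zero, sub_zero]
  exact (h.symm.eq_zero_of_eq_smul (sub_eq_zero.1 h0)).2

lemma atMostSingleValued_inv (h : IsPrimitivePair e V W) : (inv V).AtMostSingleValued :=
  atMostSingleValued_ofParam h.injective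

lemma isIrreducible_inv [CompleteSpace H] (h : IsPrimitivePair e V W) :
    (inv V).IsIrreducible := by
  refine isIrreducible_of_dense isLinearRelation_ofParam h.atMostSingleValued_inv
    (core e V) h.dense_core fun x hx => ?_
  obtain ⟨u, hu, rfl⟩ := mem_core.1 hx
  exact ⟨u, mem_inv.2 rfl, by rw [h.inner_self, hu]; ring⟩

lemma dom_inv_ne_univ (h : IsPrimitivePair e V W) : (inv V).dom ≠ Set.univ := by
  rw [dom_ofParam]
  intro huniv
  obtain ⟨x, hx⟩ := huniv.ge (Set.mem_univ e)
  exact h.ne x hx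

lemma not_isSkew_inv (h : IsPrimitivePair e V W) : ¬ (inv V).IsSkew := by
  intro hs
  have h1 := hs.2 (V e) e (mem_inv.2 rfl)
  rw [h.inner_self] at h1
  have := h.inner_self_pos
  have h2 : 0 < ⟪e, e⟫ ^ 2 := by positivity
  linarith

/-- The witness is `V e`: were it in the range of `W`, `add_eq_zero` would give `⟪e, e⟫ = 0`. -/
lemma not_dom_subset (h : IsPrimitivePair e V W) : ¬ (inv V).dom ⊆ (inv W).dom := by
  rw [dom_ofParam, dom_ofParam]
  intro hsub
  obtain ⟨w, hw⟩ := hsub ⟨e, rfl⟩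
  exact h.inner_self_pos.ne' (h.add_eq_zero hw.symm).2

lemma not_isSymmetric_inv (h : IsPrimitivePair e V W) : ¬ (inv V).IsSymmetric := by
  rintro ⟨-, hs⟩
  rw [h.adjoint_inv] at hs
  refine h.not_dom_subset fun x hx => ?_
  obtain ⟨u, hu⟩ := hx
  exact ⟨u, hs (show (x, u) ∈ (inv V).graph from hu)⟩

lemma dom_inter_dom (h : IsPrimitivePair e V W) :
    (inv V).dom ∩ (inv W).dom = core e V := by
  rw [dom_ofParam, dom_ofParam]
  ext x
  rw [SetLike.mem_coe, mem_core]
  constructor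
  · rintro ⟨⟨u, rfl⟩, w, hw⟩
    exact ⟨u, (h.add_eq_zero hw.symm).2, rfl⟩
  · rintro ⟨u, hu, rfl⟩
    exact ⟨⟨u, rfl⟩, -u, (h.eq_neg hu).symm⟩

lemma isSkew_sum_indicatorMap (h : IsPrimitivePair e V W) :
    ((inv V).sum (indicatorMap ((inv V).dom ∩ (inv W).dom))).IsSkew := by
  have hmem : ∀ x u, u ∈ (inv V).sum (indicatorMap ((inv V).dom ∩ (inv W).dom)) x ↔
      ⟪e, u⟫ = 0 ∧ V u = x := by
    intro x u
    rw [h.dom_inter_dom]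
    constructor
    · rintro ⟨u', hu', _, ⟨hx, rfl⟩, rfl⟩
      rw [mem_inv] at hu'
      rw [add_zero]
      refine ⟨?_, hu'⟩
      obtain ⟨w, hw, rfl⟩ := mem_core.1 hx
      -- Injectivity of `V` identifies the preimage `u'` with the one known to be orthogonal to `e`.
      have : u' - w = 0 := h.injective _ (by rw [map_sub, hu', sub_self])
      rwa [sub_eq_zero.1 this]
    · rintro ⟨hu, rfl⟩
      exact ⟨u, mem_inv.2 rfl, 0, ⟨mem_core.2 ⟨u, hu, rfl⟩, rfl⟩, (add_zero u).symm⟩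
  refine ⟨⟨(LinearMap.ker (innerₛₗ ℝ e)).map (V.prod LinearMap.id), ?_⟩, fun x u hu => ?_⟩
  · ext ⟨x, u⟩
    simp only [graph, Set.mem_ofPred_eq, hmem]
    simp
  · obtain ⟨h1, rfl⟩ := (hmem x u).1 hu
    rw [h.inner_self, h1]
    ring

lemma subdifferential_sq (e x : H) :
    subdifferential (fun x : H => (((1 / 4) * ⟪e, x⟫ ^ 2 : ℝ) : EReal)) x =
      {(1 / 2 * ⟪e, x⟫) • e} := by
  ext u
  rw [mem_subdifferential_coe (φ := fun x => (1 / 4) * ⟪e, x⟫ ^ 2), Set.mem_singleton_iff]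
  constructor
  · intro h
    rw [← sub_eq_zero, ← inner_self_eq_zero (𝕜 := ℝ)]
    set w := u - (1 / 2 * ⟪e, x⟫) • e with hw
    have hu : ⟪w, u⟫ = ⟪w, w⟫ + 1 / 2 * ⟪e, x⟫ * ⟪e, w⟫ := by
      conv_lhs => rw [show u = w + (1 / 2 * ⟪e, x⟫) • e by rw [hw]; abel]
      rw [inner_add_right, real_inner_smul_right, real_inner_comm w e]
    have key : ∀ t : ℝ, t * ⟪w, w⟫ ≤ t ^ 2 * ((1 / 4) * ⟪e, w⟫ ^ 2) := by
      intro t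
      have := h (x + t • w)
      rw [add_sub_cancel_left, real_inner_smul_left, hu, inner_add_right,
        real_inner_smul_right] at this
      nlinarith
    set k := (1 / 4) * ⟪e, w⟫ ^ 2
    have hk : 0 ≤ k := by positivity
    set q := ⟪w, w⟫
    have := key (q / (k + 1))
    rw [div_pow, div_mul_eq_mul_div, div_mul_eq_mul_div, div_le_div_iff₀ (by positivity)
      (by positivity)] at this
    have h2 : q ^ 2 * (k + 1) ≤ 0 := by nlinarith
    have h3 : q ^ 2 ≤ 0 := by nlinarith [sq_nonneg q]
    exact pow_eq_zero_iff (two_ne_zero) |>.1 (le_antisymm h3 (sq_nonneg q))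
  · rintro rfl y
    rw [real_inner_smul_right, inner_sub_left, real_inner_comm e y, real_inner_comm e x]
    nlinarith [sq_nonneg (⟪e, y⟫ - ⟪e, x⟫)]

/-- The symmetric part of `V` is `½ e ⊗ e`, the gradient of `¼⟪e, x⟫²`, and the remainder is skew.
-/
lemma isBorweinWiersmaDecomposable (h : IsPrimitivePair e V W) :
    (ofParam LinearMap.id V).IsBorweinWiersmaDecomposable := by
  refine ⟨fun x => (((1 / 4) * ⟪e, x⟫ ^ 2 : ℝ) : EReal),
    ofParam LinearMap.id (V - (1 / 2 : ℝ) • (innerₛₗ ℝ e).smulRight e), ?_,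
    ⟨isLinearRelation_ofParam, ?_⟩, atMostSingleValued_ofParam fun s hs => hs, ?_⟩
  · refine isProperLscConvex_coe (by fun_prop) ⟨convex_univ, ?_⟩
    intro x _ y _ a b ha hb hab
    simp only [inner_add_right, real_inner_smul_right, smul_eq_mul]
    obtain rfl : b = 1 - a := by linarith
    nlinarith [mul_nonneg (mul_nonneg ha hb) (sq_nonneg (⟪e, x⟫ - ⟪e, y⟫))]
  · rintro _ _ ⟨x, rfl, rfl⟩
    simp only [LinearMap.id_apply, LinearMap.sub_apply, LinearMap.smul_apply,
      LinearMap.smulRight_apply, innerₛₗ_apply_apply]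
    rw [inner_sub_right, real_inner_comm, h.inner_self, real_inner_smul_right,
      real_inner_smul_right, real_inner_comm]
    ring
  · funext x
    ext u
    simp only [sum, subdifferential_sq, mem_ofParam, Set.mem_ofPred_eq, Set.mem_singleton_iff,
      LinearMap.id_apply, exists_eq_left, LinearMap.sub_apply, LinearMap.smul_apply,
      LinearMap.smulRight_apply, innerₛₗ_apply_apply, smul_smul]
    constructor
    · rintro rfl
      exact ⟨_, rfl, by abel⟩
    · rintro ⟨_, rfl, rfl⟩
      abel

end IsPrimitivePair

end PrimitivePair

end SetOp

/-! ### The operator on `ℓ²` and its adjoint via the shifts. -/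

section SequenceSpace

lemma memℓp_two_iff {f : ℕ → ℝ} : Memℓp f 2 ↔ Summable fun n => f n ^ 2 := by
  rw [memℓp_gen_iff (by norm_num)]
  simp

namespace SeqL2

lemma summable_sq (x : SeqL2) : Summable fun n => x n ^ 2 := memℓp_two_iff.1 (lp.memℓp x)

lemma inner_eq_tsum_mul (x y : SeqL2) : inner ℝ x y = ∑' n, x n * y n := by
  rw [lp.inner_eq_tsum]
  simp [mul_comm]

lemma summable_mul (x y : SeqL2) : Summable fun n => x n * y n := by
  have := lp.summable_inner (𝕜 := ℝ) x y
  simpa [mul_comm] using this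

lemma norm_sq_eq_tsum (x : SeqL2) : ‖x‖ ^ 2 = ∑' n, x n ^ 2 := by
  rw [← real_inner_self_eq_norm_sq, inner_eq_tsum_mul]
  simp only [pow_two]

lemma tendsto_zero (x : SeqL2) : Tendsto (fun n => x n) atTop (𝓝 0) := by
  rw [tendsto_zero_iff_abs_tendsto_zero]
  have h := (Real.continuous_sqrt.tendsto 0).comp (summable_sq x).tendsto_atTop_zero
  simpa [Function.comp_def, Real.sqrt_sq_eq_abs] using h

/-- The sequence `(0, s₀, s₁, …)`. -/
def shiftFun (s : ℕ → ℝ) (n : ℕ) : ℝ := Nat.casesOn n 0 s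

@[simp] lemma shiftFun_zero (s : ℕ → ℝ) : shiftFun s 0 = 0 := rfl

@[simp] lemma shiftFun_succ (s : ℕ → ℝ) (n : ℕ) : shiftFun s (n + 1) = s n := rfl

/-- The right shift on `ℓ²`. -/
def rightShift : SeqL2 →ₗ[ℝ] SeqL2 where
  toFun s := ⟨shiftFun s, memℓp_two_iff.2 ((summable_nat_add_iff 1).1 (summable_sq s))⟩
  map_add' s t := by
    ext n
    cases n
    · exact (add_zero (0 : ℝ)).symm
    · rfl
  map_smul' c s := by
    ext n
    cases n
    · exact (mul_zero c).symm
    · rfl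

/-- The left shift on `ℓ²`. -/
def leftShift : SeqL2 →ₗ[ℝ] SeqL2 where
  toFun s := ⟨fun n => s (n + 1), memℓp_two_iff.2 ((summable_nat_add_iff 1).2 (summable_sq s))⟩
  map_add' s t := by
    rfl
  map_smul' c s := by
    rfl

@[simp] lemma rightShift_zero (s : SeqL2) : rightShift s 0 = 0 := rfl

@[simp] lemma rightShift_succ (s : SeqL2) (n : ℕ) : rightShift s (n + 1) = s n := rfl

@[simp] lemma leftShift_apply (s : SeqL2) (n : ℕ) : leftShift s n = s (n + 1) := rfl

lemma leftShift_rightShift (s : SeqL2) : leftShift (rightShift s) = s := by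
  ext n
  simp

lemma inner_rightShift (x y : SeqL2) : inner ℝ (rightShift x) y = inner ℝ x (leftShift y) := by
  rw [inner_eq_tsum_mul, inner_eq_tsum_mul, (summable_mul _ _).tsum_eq_zero_add]
  simp

lemma norm_rightShift (x : SeqL2) : ‖rightShift x‖ = ‖x‖ := by
  rw [← sq_eq_sq₀ (norm_nonneg _) (norm_nonneg _), ← real_inner_self_eq_norm_sq,
    inner_rightShift, leftShift_rightShift, real_inner_self_eq_norm_sq]

lemma norm_leftShift_le (x : SeqL2) : ‖leftShift x‖ ≤ ‖x‖ := by
  rw [← sq_le_sq₀ (norm_nonneg _) (norm_nonneg _), norm_sq_eq_tsum, norm_sq_eq_tsum,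
    (summable_sq x).tsum_eq_zero_add]
  simp only [leftShift_apply]
  have := sq_nonneg (x 0)
  linarith

lemma eq_zero_of_leftShift_eq {x : SeqL2} (hx : x - leftShift x = 0) : x = 0 := by
  have hsucc : ∀ n, x (n + 1) = x n := fun n => by
    conv_rhs => rw [sub_eq_zero.1 hx]
    rw [leftShift_apply]
  have hconst : ∀ n, x n = x 0 := fun n => by
    induction n with
    | zero => rfl
    | succ n ih => rw [hsucc, ih]
  have h0 : x 0 = 0 :=
    tendsto_nhds_unique (tendsto_const_nhds.congr fun n => (hconst n).symm) (tendsto_zero x)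
  ext n
  rw [hconst, h0]
  rfl

lemma eq_zero_of_rightShift_eq {x : SeqL2} (hx : x - rightShift x = 0) : x = 0 := by
  have h := sub_eq_zero.1 hx
  ext n
  induction n with
  | zero => rw [h]; rfl
  | succ n ih => rw [h, rightShift_succ, ih]; rfl

lemma sum_range_sub_rightShift (s : SeqL2) (n : ℕ) :
    ∑ i ∈ Finset.range n, (s - rightShift s) i = rightShift s n := by
  induction n with
  | zero => simp
  | succ n ih => rw [Finset.sum_range_succ, ih]; simp

lemma sum_Ioc_sub_leftShift (s : SeqL2) {n N : ℕ} (h : n ≤ N) :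
    ∑ i ∈ Finset.Ioc n N, (s - leftShift s) i = s (n + 1) - s (N + 1) := by
  induction N, h using Nat.le_induction with
  | base => simp
  | succ N h ih => rw [Finset.sum_Ioc_succ_top (by lia), ih]; simp

/-- A vector orthogonal to the range is fixed by the left shift, so it is a constant sequence in
`ℓ²`. -/
lemma dense_range_sub_rightShift :
    Dense (LinearMap.range (LinearMap.id - rightShift : SeqL2 →ₗ[ℝ] SeqL2) : Set SeqL2) := by
  rw [Submodule.dense_iff_topologicalClosure_eq_top, Submodule.topologicalClosure_eq_top_iff,
    Submodule.eq_bot_iff]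
  intro z hz
  rw [Submodule.mem_orthogonal] at hz
  refine eq_zero_of_leftShift_eq (ext_inner_left ℝ fun s => ?_)
  have := hz _ ⟨s, rfl⟩
  rw [LinearMap.sub_apply, LinearMap.id_apply, inner_sub_left, inner_rightShift] at this
  rw [inner_sub_right, this, inner_zero_right]

end SeqL2

open SeqL2 SetOp

lemma skewSum_eq_ofCayley : skewSum = ofCayley rightShift := by
  funext y
  ext z
  rw [mem_ofCayley]
  constructor
  -- The parameter is the sequence of partial sums `∑_{i≤n} y_i`. Its membership in `ℓ²` already
  -- makes it tend to `0`.
  · rintro ⟨-, hs, hz⟩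
    have hshift : ∀ n, rightShift ⟨_, hs⟩ n = ∑ i ∈ Finset.range n, y i := by
      rintro (_ | n)
      · rfl
      · rfl
    refine ⟨⟨_, hs⟩, ?_, ?_⟩
    · ext n
      rw [lp.coeFn_sub, Pi.sub_apply, hshift]
      simp [Finset.sum_range_succ]
    · ext n
      rw [lp.coeFn_smul, lp.coeFn_add, Pi.smul_apply, Pi.add_apply, hshift, hz]
      simp only [Finset.sum_range_succ, smul_eq_mul]
      ring
  · rintro ⟨s, rfl, rfl⟩
    refine ⟨?_, ?_, fun n => ?_⟩
    · simp only [sum_range_sub_rightShift]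
      exact tendsto_zero _
    · simp only [sum_range_sub_rightShift, rightShift_succ]
      exact lp.memℓp s
    · rw [sum_range_sub_rightShift]
      simp only [lp.coeFn_smul, lp.coeFn_add, lp.coeFn_sub, Pi.smul_apply, Pi.add_apply,
        Pi.sub_apply, smul_eq_mul]
      ring

lemma adjoint_skewSum : skewSum.adjoint = ofCayley leftShift := by
  rw [skewSum_eq_ofCayley, adjoint_ofCayley inner_rightShift]

lemma IsTailSum.eq_add {y t : ℕ → ℝ} (h : IsTailSum y t) (n : ℕ) :
    t n = y (n + 1) + t (n + 1) := by
  refine tendsto_nhds_unique (h n) ((tendsto_const_nhds.add (h (n + 1))).congr' ?_)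
  filter_upwards [eventually_ge_atTop (n + 1)] with N hN
  rw [← Finset.sum_Ioc_consecutive _ n.le_succ hN]
  simp

lemma mem_adjoint_skewSum {y z : SeqL2} : z ∈ skewSum.adjoint y ↔
    ∃ t : ℕ → ℝ, IsTailSum y t ∧ Memℓp t 2 ∧ ∀ n, z n = (1 / 2) * y n + t n := by
  rw [adjoint_skewSum, mem_ofCayley]
  constructor
  · rintro ⟨s, rfl, rfl⟩
    refine ⟨leftShift s, fun n => ?_, lp.memℓp _, fun n => ?_⟩
    · have hs : Tendsto (fun N : ℕ => (s (N + 1) : ℝ)) atTop (𝓝 0) :=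
        (tendsto_zero s).comp (tendsto_add_atTop_nat 1)
      have h := Tendsto.const_sub (G := ℝ) (s (n + 1)) hs
      rw [sub_zero] at h
      refine h.congr' ?_
      filter_upwards [eventually_ge_atTop n] with N hN
      rw [sum_Ioc_sub_leftShift s hN]
    · simp only [lp.coeFn_smul, lp.coeFn_add, lp.coeFn_sub, Pi.smul_apply, Pi.add_apply,
        Pi.sub_apply, smul_eq_mul]
      ring
  · rintro ⟨t, ht, htp, hz⟩
    let t' : SeqL2 := ⟨t, htp⟩
    -- The parameter is `s = y + t`, that is `s_n = ∑_{i≥n} y_i`, whose left shift is the tail `t`.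
    have hL : leftShift (y + t') = t' := by
      ext n
      exact (ht.eq_add n).symm
    refine ⟨y + t', by rw [hL, add_sub_cancel_right], ?_⟩
    rw [hL]
    ext n
    rw [hz]
    simp only [lp.coeFn_smul, lp.coeFn_add, Pi.smul_apply, Pi.add_apply, smul_eq_mul]
    change 1 / 2 * (y n + t n + t n) = _
    ring

lemma dom_skewSum : skewSum.dom =
    {y : SeqL2 | Tendsto (fun N => ∑ i ∈ Finset.range N, y i) atTop (𝓝 0) ∧
      Memℓp (fun n : ℕ => ∑ i ∈ Finset.range (n + 1), y i) 2} := by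
  ext y
  constructor
  · rintro ⟨z, h1, h2, -⟩
    exact ⟨h1, h2⟩
  · rintro ⟨h1, h2⟩
    let s : SeqL2 := ⟨_, h2⟩
    refine ⟨s - (1 / 2 : ℝ) • y, h1, h2, fun n => ?_⟩
    simp only [lp.coeFn_smul, lp.coeFn_sub, Pi.smul_apply, Pi.sub_apply, smul_eq_mul]
    change (∑ i ∈ Finset.range (n + 1), y i) - _ = _
    rw [Finset.sum_range_succ]
    ring

lemma dom_adjoint_skewSum : skewSum.adjoint.dom =
    {y : SeqL2 | ∃ t : ℕ → ℝ, IsTailSum y t ∧ Memℓp t 2} := by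
  ext y
  constructor
  · rintro ⟨z, hz⟩
    obtain ⟨t, h1, h2, -⟩ := mem_adjoint_skewSum.1 hz
    exact ⟨t, h1, h2⟩
  · rintro ⟨t, h1, h2⟩
    exact ⟨(1 / 2 : ℝ) • y + ⟨t, h2⟩, mem_adjoint_skewSum.2 ⟨t, h1, h2, fun n => rfl⟩⟩

lemma isLinearRelation_skewSum : skewSum.IsLinearRelation := by
  rw [skewSum_eq_ofCayley]
  exact isLinearRelation_ofParam

lemma isLinearRelation_adjoint_skewSum : skewSum.adjoint.IsLinearRelation := by
  rw [adjoint_skewSum]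
  exact isLinearRelation_ofParam

lemma atMostSingleValued_skewSum : skewSum.AtMostSingleValued := by
  rw [skewSum_eq_ofCayley]
  exact atMostSingleValued_ofParam fun _ => eq_zero_of_rightShift_eq

lemma atMostSingleValued_adjoint_skewSum : skewSum.adjoint.AtMostSingleValued := by
  rw [adjoint_skewSum]
  exact atMostSingleValued_ofParam fun _ => eq_zero_of_leftShift_eq

lemma isMaximalMonotone_skewSum : skewSum.IsMaximalMonotone := by
  rw [skewSum_eq_ofCayley]
  exact isMaximalMonotone_ofCayley fun s => (norm_rightShift s).le

lemma isMaximalMonotone_adjoint_skewSum : skewSum.adjoint.IsMaximalMonotone := by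
  rw [adjoint_skewSum]
  exact isMaximalMonotone_ofCayley norm_leftShift_le

lemma isSkew_skewSum : skewSum.IsSkew := by
  refine ⟨isLinearRelation_skewSum, fun x u hu => ?_⟩
  rw [skewSum_eq_ofCayley] at hu
  obtain ⟨s, rfl, rfl⟩ := mem_ofCayley.1 hu
  rw [inner_ofCayley, norm_rightShift]
  ring

lemma dom_skewSum_eq_range :
    skewSum.dom = LinearMap.range (LinearMap.id - rightShift : SeqL2 →ₗ[ℝ] SeqL2) := by
  rw [skewSum_eq_ofCayley, ofCayley, dom_ofParam]
  rfl

lemma dense_dom_skewSum : Dense skewSum.dom := by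
  rw [dom_skewSum_eq_range]
  exact dense_range_sub_rightShift

lemma neg_mem_adjoint_skewSum {y u : SeqL2} (hu : u ∈ skewSum y) : -u ∈ skewSum.adjoint y := by
  rw [skewSum_eq_ofCayley] at hu
  obtain ⟨s, rfl, rfl⟩ := mem_ofCayley.1 hu
  rw [adjoint_skewSum, mem_ofCayley]
  -- The left shift undoes the right one, so this parameter gives the same point `s - rightShift s`
  -- and the opposite value.
  refine ⟨-rightShift s, ?_, ?_⟩
  · rw [map_neg, leftShift_rightShift]
    abel
  · rw [map_neg, leftShift_rightShift]
    module

lemma mem_adjoint_skewSum_iff_neg_mem {y : SeqL2} (hy : y ∈ skewSum.dom) (z : SeqL2) :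
    z ∈ skewSum.adjoint y ↔ -z ∈ skewSum y := by
  obtain ⟨u, hu⟩ := hy
  have hu' := neg_mem_adjoint_skewSum hu
  constructor
  · intro hz
    rw [atMostSingleValued_adjoint_skewSum y hz hu', neg_neg]
    exact hu
  · intro hz
    have := neg_mem_adjoint_skewSum hz
    rwa [neg_neg] at this

lemma isIrreducible_skewSum : skewSum.IsIrreducible := by
  refine isIrreducible_of_dense isLinearRelation_skewSum atMostSingleValued_skewSum _
    dense_range_sub_rightShift fun x hx => ?_
  rw [← SetLike.mem_coe, ← dom_skewSum_eq_range] at hx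
  obtain ⟨u, hu⟩ := hx
  exact ⟨u, hu, isSkew_skewSum.2 x u hu⟩

lemma isIrreducible_adjoint_skewSum : skewSum.adjoint.IsIrreducible := by
  refine isIrreducible_of_dense isLinearRelation_adjoint_skewSum
    atMostSingleValued_adjoint_skewSum _ dense_range_sub_rightShift fun x hx => ?_
  rw [← SetLike.mem_coe, ← dom_skewSum_eq_range] at hx
  obtain ⟨u, hu⟩ := hx
  exact ⟨-u, neg_mem_adjoint_skewSum hu, by rw [inner_neg_right, isSkew_skewSum.2 x u hu, neg_zero]⟩

lemma leftShift_single_zero : leftShift (lp.single 2 0 1) = 0 := by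
  ext n
  simp

lemma single_zero_mem_dom_adjoint_skewSum :
    (lp.single 2 0 1 : SeqL2) ∈ skewSum.adjoint.dom := by
  rw [adjoint_skewSum]
  exact ⟨_, mem_ofCayley.2 ⟨lp.single 2 0 1, by rw [leftShift_single_zero, sub_zero], rfl⟩⟩

lemma not_isSkew_adjoint_skewSum : ¬ skewSum.adjoint.IsSkew := by
  rintro ⟨-, h⟩
  rw [adjoint_skewSum] at h
  have := h _ _ (mem_ofCayley.2 ⟨lp.single 2 0 1, rfl, rfl⟩)
  rw [inner_ofCayley, leftShift_single_zero, lp.norm_single (by norm_num)] at this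
  norm_num at this

lemma dom_skewSum_ssubset : skewSum.dom ⊂ skewSum.adjoint.dom := by
  rw [Set.ssubset_iff_of_subset]
  · refine ⟨_, single_zero_mem_dom_adjoint_skewSum, ?_⟩
    rintro ⟨z, h, -⟩
    have h1 := h.comp (tendsto_add_atTop_nat 1)
    refine zero_ne_one (tendsto_nhds_unique h1 (tendsto_const_nhds.congr fun n => ?_))
    simp only [Function.comp_apply]
    rw [Finset.sum_eq_single_of_mem 0 (by simp) (fun i _ hi => lp.single_apply_ne _ _ _ hi),
      lp.single_apply_self]
  · rintro y ⟨u, hu⟩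
    exact ⟨_, neg_mem_adjoint_skewSum hu⟩

lemma dom_adjoint_skewSum_ne_univ : skewSum.adjoint.dom ≠ Set.univ := by
  intro h
  -- The sequence `1/(n+1)` is in `ℓ²`, but its series diverges, so it has no tail sums.
  have hp : Memℓp (fun n : ℕ => (1 : ℝ) / (n + 1)) 2 := by
    rw [memℓp_two_iff]
    have := (summable_nat_add_iff 1).2 (Real.summable_one_div_nat_pow.2 one_lt_two)
    simpa using this
  have hy := h.ge (Set.mem_univ (⟨_, hp⟩ : SeqL2))
  rw [dom_adjoint_skewSum] at hy
  obtain ⟨t, ht, -⟩ := hy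
  refine not_tendsto_nhds_of_tendsto_atTop
    (Real.tendsto_sum_range_one_div_nat_succ_atTop.comp (tendsto_add_atTop_nat 1)) (1 + t 0)
    (((ht 0).const_add 1).congr fun N => ?_)
  change 1 + ∑ i ∈ Finset.Ioc 0 N, (1 : ℝ) / (i + 1) =
    ∑ i ∈ Finset.range (N + 1), (1 : ℝ) / (i + 1)
  induction N with
  | zero => simp
  | succ N ih => rw [Finset.sum_Ioc_succ_top (Nat.zero_le N), ← add_assoc, ih,
      Finset.sum_range_succ _ (N + 1)]

lemma dom_skewSum_ne_univ : skewSum.dom ≠ Set.univ := fun h =>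
  dom_adjoint_skewSum_ne_univ (Set.univ_subset_iff.1 (h ▸ dom_skewSum_ssubset.subset))

end SequenceSpace

/-! ### The Volterra operator on `L²[0,1]`. -/

section Volterra

open Set SetOp

lemma ae_volume01_iff {p : ℝ → Prop} :
    (∀ᵐ t ∂volume01, p t) ↔ ∀ᵐ t, t ∈ Ioo (0 : ℝ) 1 → p t := by
  rw [volume01, ← restrict_Ioo_eq_restrict_Icc, ae_restrict_iff' measurableSet_Ioo]

lemma ContinuousOn.memLp_volume01 {g : ℝ → ℝ} (hg : ContinuousOn g (Icc 0 1)) :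
    MemLp g 2 volume01 := by
  obtain ⟨C, hC⟩ := isCompact_Icc.exists_bound_of_continuousOn hg
  exact MemLp.of_bound (hg.aestronglyMeasurable measurableSet_Icc) C
    (ae_restrict_of_forall_mem measurableSet_Icc hC)

lemma integral_volume01 (f : ℝ → ℝ) : ∫ t, f t ∂volume01 = ∫ t in (0 : ℝ)..1, f t := by
  rw [intervalIntegral.integral_of_le zero_le_one, integral_Icc_eq_integral_Ioc]

lemma intervalIntegral_congr_volume01 {f g : ℝ → ℝ} (h : f =ᵐ[volume01] g) {a b : ℝ}
    (ha : a ∈ Icc (0 : ℝ) 1) (hb : b ∈ Icc (0 : ℝ) 1) :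
    ∫ s in a..b, f s = ∫ s in a..b, g s := by
  refine intervalIntegral.integral_congr_ae_restrict
    (ae_restrict_of_ae_restrict_of_subset ?_ h)
  exact uIoc_subset_uIcc.trans (uIcc_subset_Icc ha hb)

namespace L201

lemma integrable (x : L201) : Integrable x volume01 :=
  (Lp.memLp x).integrable one_le_two

lemma intervalIntegrable (x : L201) : IntervalIntegrable x volume 0 1 :=
  (intervalIntegrable_iff_integrableOn_Icc_of_le zero_le_one).2 (integrable x)

lemma intervalIntegrable_of_mem (x : L201) {a b : ℝ} (ha : a ∈ Icc (0 : ℝ) 1)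
    (hb : b ∈ Icc (0 : ℝ) 1) : IntervalIntegrable x volume a b :=
  (intervalIntegrable x).mono_set (by
    rw [uIcc_of_le zero_le_one]
    exact uIcc_subset_Icc ha hb)

lemma absolutelyContinuousOnInterval_integral (x : L201) {c : ℝ} (hc : c ∈ Icc (0 : ℝ) 1) :
    AbsolutelyContinuousOnInterval (fun t => ∫ s in c..t, x s) 0 1 :=
  (intervalIntegrable x).absolutelyContinuousOnInterval_intervalIntegral
    (by rwa [uIcc_of_le zero_le_one])

lemma continuousOn_integral (x : L201) {c : ℝ} (hc : c ∈ Icc (0 : ℝ) 1) :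
    ContinuousOn (fun t => ∫ s in c..t, x s) (Icc 0 1) := by
  have := (absolutelyContinuousOnInterval_integral x hc).continuousOn
  rwa [uIcc_of_le zero_le_one] at this

lemma deriv_integral_ae_eq (x : L201) {c : ℝ} (hc : c ∈ Icc (0 : ℝ) 1) :
    deriv (fun t => ∫ s in c..t, x s) =ᵐ[volume01] x := by
  have h := (intervalIntegrable x).ae_hasDerivAt_integral
  rw [uIcc_of_le zero_le_one] at h
  refine (ae_restrict_iff' measurableSet_Icc).2 ?_
  filter_upwards [h] with t ht htI
  exact (ht htI c hc).deriv

/-- The constant function `1`. -/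
noncomputable def one : L201 := (memLp_const (1 : ℝ)).toLp

lemma coeFn_one : (one : ℝ → ℝ) =ᵐ[volume01] fun _ => 1 := MemLp.coeFn_toLp _

lemma inner_one (x : L201) : inner ℝ one x = ∫ s in (0 : ℝ)..1, x s := by
  rw [L2.inner_def, ← integral_volume01]
  refine integral_congr_ae ?_
  filter_upwards [coeFn_one] with t ht
  rw [ht]
  simp

/-- The Volterra operator as a linear map. -/
noncomputable def volterraMap : L201 →ₗ[ℝ] L201 where
  toFun x := (continuousOn_integral x (left_mem_Icc.2 zero_le_one)).memLp_volume01.toLp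
  map_add' x y := by
    rw [← MemLp.toLp_add]
    refine MemLp.toLp_congr _ _ (ae_restrict_of_forall_mem measurableSet_Icc fun t ht => ?_)
    have h0 : (0 : ℝ) ∈ Icc (0 : ℝ) 1 := left_mem_Icc.2 zero_le_one
    exact (intervalIntegral_congr_volume01 (Lp.coeFn_add x y) h0 ht).trans <|
      intervalIntegral.integral_add (intervalIntegrable_of_mem x h0 ht)
      (intervalIntegrable_of_mem y h0 ht)
  map_smul' c x := by
    rw [RingHom.id_apply, ← MemLp.toLp_const_smul]
    refine MemLp.toLp_congr _ _ (ae_restrict_of_forall_mem measurableSet_Icc fun t ht => ?_)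
    have h0 : (0 : ℝ) ∈ Icc (0 : ℝ) 1 := left_mem_Icc.2 zero_le_one
    exact (intervalIntegral_congr_volume01 (Lp.coeFn_smul c x) h0 ht).trans <|
      intervalIntegral.integral_smul c _

lemma coeFn_volterraMap (x : L201) :
    volterraMap x =ᵐ[volume01] fun t => ∫ s in (0 : ℝ)..t, x s :=
  (continuousOn_integral x (left_mem_Icc.2 zero_le_one)).memLp_volume01.coeFn_toLp

/-- The operator `(W x)(t) = ∫ₜ¹ x` as a linear map. -/
noncomputable def volterraMapAdjoint : L201 →ₗ[ℝ] L201 :=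
  (innerₛₗ ℝ one).smulRight one - volterraMap

lemma volterraMapAdjoint_apply (x : L201) :
    volterraMapAdjoint x = inner ℝ one x • one - volterraMap x := rfl

lemma coeFn_volterraMapAdjoint (x : L201) :
    volterraMapAdjoint x =ᵐ[volume01] fun t => ∫ s in t..(1 : ℝ), x s := by
  have h0 : (0 : ℝ) ∈ Icc (0 : ℝ) 1 := left_mem_Icc.2 zero_le_one
  have h1 : (1 : ℝ) ∈ Icc (0 : ℝ) 1 := right_mem_Icc.2 zero_le_one
  rw [volterraMapAdjoint_apply]
  filter_upwards [Lp.coeFn_sub (inner ℝ one x • one) (volterraMap x),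
    Lp.coeFn_smul (inner ℝ one x) one, coeFn_one, coeFn_volterraMap x,
    ae_restrict_mem measurableSet_Icc] with t ht1 ht2 ht3 ht4 ht
  rw [ht1, Pi.sub_apply, ht2, Pi.smul_apply, ht3, ht4, inner_one, smul_eq_mul, mul_one,
    sub_eq_iff_eq_add, add_comm]
  exact (intervalIntegral.integral_add_adjacent_intervals (intervalIntegrable_of_mem x h0 ht)
    (intervalIntegrable_of_mem x ht h1)).symm

/-- Integration by parts: both primitives vanish at `0`, so only the boundary term at `1` remains.
-/
lemma inner_volterraMap_add (x y : L201) :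
    inner ℝ (volterraMap x) y + inner ℝ x (volterraMap y) = inner ℝ one x * inner ℝ one y := by
  have h0 : (0 : ℝ) ∈ Icc (0 : ℝ) 1 := left_mem_Icc.2 zero_le_one
  have h := (absolutelyContinuousOnInterval_integral x h0).integral_deriv_mul_eq_sub
    (absolutelyContinuousOnInterval_integral y h0)
  rw [intervalIntegral.integral_same, zero_mul, sub_zero, ← integral_volume01] at h
  rw [inner_one, inner_one, ← h, L2.inner_def, L2.inner_def,
    ← integral_add (L2.integrable_inner _ _) (L2.integrable_inner _ _)]
  refine integral_congr_ae ?_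
  filter_upwards [(deriv_integral_ae_eq x h0), (deriv_integral_ae_eq y h0), coeFn_volterraMap x,
    coeFn_volterraMap y] with t hx hy hVx hVy
  rw [hx, hy, hVx, hVy]
  simp only [RCLike.inner_apply, conj_trivial]
  ring

/-- The continuous primitive equals `c` on all of `[0,1]`. Its value at `0` gives `c = 0` and its
derivative gives `x = 0`. -/
lemma eq_zero_of_volterraMap_eq {x : L201} {c : ℝ} (hx : volterraMap x = c • one) :
    c = 0 ∧ x = 0 := by
  have h0 : (0 : ℝ) ∈ Icc (0 : ℝ) 1 := left_mem_Icc.2 zero_le_one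
  have hae : (fun t => ∫ s in (0 : ℝ)..t, x s) =ᵐ[volume01] fun _ => c := by
    have h := coeFn_volterraMap x
    rw [hx] at h
    filter_upwards [h, Lp.coeFn_smul c one, coeFn_one] with t h1 h2 h3
    rw [← h1, h2, Pi.smul_apply, h3, smul_eq_mul, mul_one]
  have heq := Measure.eqOn_Icc_of_ae_eq volume zero_ne_one hae (continuousOn_integral x h0)
    continuousOn_const
  have hc : c = 0 := by
    have := heq h0
    simpa using this.symm
  refine ⟨hc, (Lp.eq_zero_iff_ae_eq_zero).2 ?_⟩
  -- Discarding the endpoints gives each `t` a neighbourhood inside the interval, where the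
  -- primitive is constant.
  have hd := ae_volume01_iff.1 (deriv_integral_ae_eq x h0)
  refine ae_volume01_iff.2 ?_
  filter_upwards [hd] with t ht htI
  rw [← ht htI]
  have : (fun t => ∫ s in (0 : ℝ)..t, x s) =ᶠ[𝓝 t] fun _ => c := by
    filter_upwards [isOpen_Ioo.mem_nhds htI] with s hs
    exact heq (Ioo_subset_Icc_self hs)
  rw [this.deriv_eq, deriv_const, Pi.zero_apply]

lemma isPrimitivePair_volterraMap :
    IsPrimitivePair one volterraMap volterraMapAdjoint where
  inner_left x y := by
    have := inner_volterraMap_add x y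
    rw [volterraMapAdjoint_apply, inner_sub_right, real_inner_smul_right, real_inner_comm one x]
    linarith
  add_eq x := by rw [volterraMapAdjoint_apply, add_sub_cancel]
  injective x hx := (eq_zero_of_volterraMap_eq (c := 0) (by rw [hx, zero_smul])).2
  ne x hx := one_ne_zero (eq_zero_of_volterraMap_eq (c := 1) (by rw [hx, one_smul])).1

end L201

open L201 IsPrimitivePair

lemma mem_volterra {x y : L201} : y ∈ volterra x ↔ volterraMap x = y := by
  constructor
  · intro h
    exact Lp.ext ((coeFn_volterraMap x).trans (EventuallyEq.symm h))
  · rintro rfl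
    exact coeFn_volterraMap x

lemma volterra_eq_ofParam : volterra = ofParam LinearMap.id volterraMap := by
  funext x
  ext y
  simp [mem_volterra, mem_ofParam]

lemma inverseVolterra_eq_inv : inverseVolterra = inv volterraMap := by
  funext x
  ext y
  rw [IsPrimitivePair.mem_inv]
  exact mem_volterra

lemma adjoint_volterra : volterra.adjoint = ofParam LinearMap.id volterraMapAdjoint := by
  rw [volterra_eq_ofParam, isPrimitivePair_volterraMap.adjoint_ofParam_id]

lemma adjoint_inverseVolterra : inverseVolterra.adjoint = inv volterraMapAdjoint := by
  rw [inverseVolterra_eq_inv, isPrimitivePair_volterraMap.adjoint_inv]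

lemma mem_adjoint_volterra_iff_eq {x y : L201} :
    y ∈ volterra.adjoint x ↔ volterraMapAdjoint x = y := by
  rw [adjoint_volterra]
  simp [mem_ofParam]

lemma ae_eq_iff_eq {x y : L201} {f : ℝ → ℝ} (h : y =ᵐ[volume01] f) :
    x =ᵐ[volume01] f ↔ y = x := by
  constructor
  · intro hx
    exact Lp.ext (h.trans hx.symm)
  · rintro rfl
    exact h

lemma mem_adjoint_volterra {x y : L201} :
    y ∈ volterra.adjoint x ↔ (y : ℝ → ℝ) =ᵐ[volume01] fun t => ∫ s in t..(1 : ℝ), x s := by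
  rw [mem_adjoint_volterra_iff_eq, ae_eq_iff_eq (coeFn_volterraMapAdjoint x)]

lemma inverse_adjoint_inverseVolterra : inverseVolterra.adjoint.inverse = volterra.adjoint := by
  funext x
  ext y
  rw [mem_adjoint_volterra_iff_eq, adjoint_inverseVolterra]
  exact IsPrimitivePair.mem_inv

/-- This is the fundamental theorem of calculus for absolutely continuous functions. The default
value of `deriv` matters only on a null set. -/
lemma mem_inverseVolterra {x u : L201} : u ∈ inverseVolterra x ↔
    ∃ g, HasACRep x g ∧ g 0 = 0 ∧ (u : ℝ → ℝ) =ᵐ[volume01] deriv g := by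
  have h0 : (0 : ℝ) ∈ Icc (0 : ℝ) 1 := left_mem_Icc.2 zero_le_one
  constructor
  · intro hu
    exact ⟨_, ⟨(L201.absolutelyContinuousOnInterval_integral u h0), hu⟩,
      intervalIntegral.integral_same,
      (L201.deriv_integral_ae_eq u h0).symm⟩
  · rintro ⟨g, ⟨hg, hxg⟩, hg0, hu⟩
    refine hxg.trans (ae_restrict_of_forall_mem measurableSet_Icc fun t ht => ?_)
    have hsub : uIcc 0 t ⊆ uIcc (0 : ℝ) 1 := by
      rw [uIcc_of_le zero_le_one]
      exact uIcc_subset_Icc h0 ht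
    beta_reduce
    rw [intervalIntegral_congr_volume01 hu h0 ht, (hg.mono hsub).integral_deriv_eq_sub, hg0,
      sub_zero]

lemma mem_adjoint_inverseVolterra {x u : L201} : u ∈ inverseVolterra.adjoint x ↔
    ∃ g, HasACRep x g ∧ g 1 = 0 ∧ (u : ℝ → ℝ) =ᵐ[volume01] fun t => -deriv g t := by
  have h1 : (1 : ℝ) ∈ Icc (0 : ℝ) 1 := right_mem_Icc.2 zero_le_one
  rw [adjoint_inverseVolterra, IsPrimitivePair.mem_inv, ← ae_eq_iff_eq (coeFn_volterraMapAdjoint u)]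
  constructor
  · intro hu
    -- Basing the primitive at `1` makes the boundary value there zero.
    refine ⟨fun t => -∫ s in (1 : ℝ)..t, u s,
      ⟨(L201.absolutelyContinuousOnInterval_integral u h1).neg, ?_⟩, by simp, ?_⟩
    · simpa only [← intervalIntegral.integral_symm] using hu
    · filter_upwards [(L201.deriv_integral_ae_eq u h1)] with t ht
      rw [deriv.fun_neg, neg_neg, ht]
  · rintro ⟨g, ⟨hg, hxg⟩, hg1, hu⟩
    refine hxg.trans (ae_restrict_of_forall_mem measurableSet_Icc fun t ht => ?_)
    have hsub : uIcc t 1 ⊆ uIcc (0 : ℝ) 1 := by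
      rw [uIcc_of_le zero_le_one]
      exact uIcc_subset_Icc ht h1
    beta_reduce
    rw [intervalIntegral_congr_volume01 hu ht h1, intervalIntegral.integral_neg,
      (hg.mono hsub).integral_deriv_eq_sub, hg1, zero_sub, neg_neg]

lemma dom_inverseVolterra : inverseVolterra.dom =
    {x | ∃ g, HasACRep x g ∧ g 0 = 0 ∧ MemLp (deriv g) 2 volume01} := by
  ext x
  constructor
  · rintro ⟨u, hu⟩
    obtain ⟨g, h1, h2, h3⟩ := mem_inverseVolterra.1 hu
    exact ⟨g, h1, h2, (memLp_congr_ae h3).1 (Lp.memLp u)⟩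
  · rintro ⟨g, h1, h2, h3⟩
    exact ⟨h3.toLp, mem_inverseVolterra.2 ⟨g, h1, h2, h3.coeFn_toLp⟩⟩

lemma dom_adjoint_inverseVolterra : inverseVolterra.adjoint.dom =
    {x | ∃ g, HasACRep x g ∧ g 1 = 0 ∧ MemLp (deriv g) 2 volume01} := by
  ext x
  constructor
  · rintro ⟨u, hu⟩
    obtain ⟨g, h1, h2, h3⟩ := mem_adjoint_inverseVolterra.1 hu
    refine ⟨g, h1, h2, ?_⟩
    have := ((memLp_congr_ae h3).1 (Lp.memLp u)).neg
    simpa only [Pi.neg_def, neg_neg] using this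
  · rintro ⟨g, h1, h2, h3⟩
    exact ⟨h3.neg.toLp, mem_adjoint_inverseVolterra.2 ⟨g, h1, h2, h3.neg.coeFn_toLp⟩⟩

end Volterra

/-! ### Assembly of the results for the two spaces. -/

theorem mainTheorem8 :
    -- the four operators
    (∀ T ∈ ({skewSum, skewSum.adjoint} : Set (SetOp SeqL2)),
      T.IsLinearRelation ∧ T.AtMostSingleValued ∧ T.IsMaximalMonotone ∧
      T.IsIrreducible ∧ T.IsAsplundDecomposable ∧ T.dom ≠ Set.univ) ∧
    (∀ T ∈ ({inverseVolterra, inverseVolterra.adjoint} : Set (SetOp L201)),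
      T.IsLinearRelation ∧ T.AtMostSingleValued ∧ T.IsMaximalMonotone ∧
      T.IsIrreducible ∧ T.IsAsplundDecomposable ∧ T.dom ≠ Set.univ) ∧
    -- Borwein-Wiersma decomposability
    (skewSum.IsBorweinWiersmaDecomposable ∧
      ¬ skewSum.adjoint.IsBorweinWiersmaDecomposable ∧
      ¬ inverseVolterra.IsBorweinWiersmaDecomposable ∧
      ¬ inverseVolterra.adjoint.IsBorweinWiersmaDecomposable ∧
      volterra.IsBorweinWiersmaDecomposable ∧
      volterra.adjoint.IsBorweinWiersmaDecomposable) ∧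
    -- further properties of the operator on `ℓ²` and of its adjoint
    (skewSum.dom = {y : SeqL2 | Tendsto (fun N => ∑ i ∈ Finset.range N, y i) atTop (𝓝 0) ∧
        Memℓp (fun n : ℕ => ∑ i ∈ Finset.range (n + 1), y i) 2} ∧
      skewSum.adjoint.dom = {y : SeqL2 | ∃ t : ℕ → ℝ, IsTailSum y t ∧ Memℓp t 2} ∧
      (∀ y z : SeqL2, z ∈ skewSum.adjoint y ↔
        ∃ t : ℕ → ℝ, IsTailSum y t ∧ Memℓp t 2 ∧ ∀ n, z n = (1 / 2) * y n + t n) ∧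
      skewSum.IsSkew ∧ ¬ skewSum.adjoint.IsSkew ∧
      Dense skewSum.dom ∧ skewSum.dom ⊂ skewSum.adjoint.dom ∧
      (∀ y ∈ skewSum.dom, ∀ z, z ∈ skewSum.adjoint y ↔ -z ∈ skewSum y)) ∧
    -- further properties of the Volterra operator, its inverse and their adjoints
    ((∀ x, ∃! y, y ∈ volterra x) ∧
      (∀ x, ∃! y, y ∈ volterra.adjoint x) ∧
      (∀ x y : L201, y ∈ volterra.adjoint x ↔
        (y : ℝ → ℝ) =ᵐ[volume01] fun t => ∫ s in t..(1 : ℝ), x s) ∧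
      inverseVolterra.adjoint.inverse = volterra.adjoint ∧
      inverseVolterra.dom = {x | ∃ g, HasACRep x g ∧ g 0 = 0 ∧ MemLp (deriv g) 2 volume01} ∧
      (∀ x u : L201, u ∈ inverseVolterra x ↔
        ∃ g, HasACRep x g ∧ g 0 = 0 ∧ (u : ℝ → ℝ) =ᵐ[volume01] deriv g) ∧
      inverseVolterra.adjoint.dom =
        {x | ∃ g, HasACRep x g ∧ g 1 = 0 ∧ MemLp (deriv g) 2 volume01} ∧
      (∀ x u : L201, u ∈ inverseVolterra.adjoint x ↔
        ∃ g, HasACRep x g ∧ g 1 = 0 ∧ (u : ℝ → ℝ) =ᵐ[volume01] fun t => -deriv g t) ∧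
      (¬ inverseVolterra.IsSymmetric ∧ ¬ inverseVolterra.adjoint.IsSymmetric) ∧
      (¬ inverseVolterra.IsSkew ∧ ¬ inverseVolterra.adjoint.IsSkew) ∧
      (¬ inverseVolterra.dom ⊆ inverseVolterra.adjoint.dom ∧
        ¬ inverseVolterra.adjoint.dom ⊆ inverseVolterra.dom) ∧
      Dense (inverseVolterra.dom ∩ inverseVolterra.adjoint.dom) ∧
      (inverseVolterra.sum (SetOp.indicatorMap
        (inverseVolterra.dom ∩ inverseVolterra.adjoint.dom))).IsSkew ∧
      (inverseVolterra.adjoint.sum (SetOp.indicatorMap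
        (inverseVolterra.dom ∩ inverseVolterra.adjoint.dom))).IsSkew) := by
  have hV := L201.isPrimitivePair_volterraMap
  have hW := hV.symm
  have hA := inverseVolterra_eq_inv
  have hA' := adjoint_inverseVolterra
  refine ⟨?_, ?_, ⟨isSkew_skewSum.isBorweinWiersmaDecomposable atMostSingleValued_skewSum,
    fun h => not_isSkew_adjoint_skewSum
      (isIrreducible_adjoint_skewSum.isSkew isLinearRelation_adjoint_skewSum h),
    fun h => hV.not_isSkew_inv
      (hV.isIrreducible_inv.isSkew SetOp.isLinearRelation_ofParam (hA ▸ h)),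
    fun h => hW.not_isSkew_inv
      (hW.isIrreducible_inv.isSkew SetOp.isLinearRelation_ofParam (hA' ▸ h)), ?_, ?_⟩,
    ⟨dom_skewSum, dom_adjoint_skewSum, fun _ _ => mem_adjoint_skewSum, isSkew_skewSum,
      not_isSkew_adjoint_skewSum, dense_dom_skewSum, dom_skewSum_ssubset,
      fun _ hy z => mem_adjoint_skewSum_iff_neg_mem hy z⟩,
    ⟨fun x => ?_, fun x => ?_, fun _ _ => mem_adjoint_volterra, inverse_adjoint_inverseVolterra,
      dom_inverseVolterra, fun _ _ => mem_inverseVolterra, dom_adjoint_inverseVolterra,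
      fun _ _ => mem_adjoint_inverseVolterra, ?_⟩⟩
  · rintro T (rfl | rfl)
    · exact ⟨isLinearRelation_skewSum, atMostSingleValued_skewSum, isMaximalMonotone_skewSum,
        isIrreducible_skewSum,
        isIrreducible_skewSum.isAsplundDecomposable isMaximalMonotone_skewSum.1,
        dom_skewSum_ne_univ⟩
    · exact ⟨isLinearRelation_adjoint_skewSum, atMostSingleValued_adjoint_skewSum,
        isMaximalMonotone_adjoint_skewSum, isIrreducible_adjoint_skewSum,
        isIrreducible_adjoint_skewSum.isAsplundDecomposable isMaximalMonotone_adjoint_skewSum.1,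
        dom_adjoint_skewSum_ne_univ⟩
  · rintro T (rfl | rfl)
    · rw [hA]
      exact ⟨SetOp.isLinearRelation_ofParam, hV.atMostSingleValued_inv,
        hV.isMaximalMonotone_inv, hV.isIrreducible_inv,
        hV.isIrreducible_inv.isAsplundDecomposable hV.isMaximalMonotone_inv.1,
        hV.dom_inv_ne_univ⟩
    · rw [hA']
      exact ⟨SetOp.isLinearRelation_ofParam, hW.atMostSingleValued_inv,
        hW.isMaximalMonotone_inv, hW.isIrreducible_inv,
        hW.isIrreducible_inv.isAsplundDecomposable hW.isMaximalMonotone_inv.1,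
        hW.dom_inv_ne_univ⟩
  · rw [volterra_eq_ofParam]
    exact hV.isBorweinWiersmaDecomposable
  · rw [adjoint_volterra]
    exact hW.isBorweinWiersmaDecomposable
  · simp only [mem_volterra]
    exact existsUnique_eq'
  · simp only [mem_adjoint_volterra_iff_eq]
    exact existsUnique_eq'
  · rw [hA', hA]
    refine ⟨⟨hV.not_isSymmetric_inv, hW.not_isSymmetric_inv⟩,
      ⟨hV.not_isSkew_inv, hW.not_isSkew_inv⟩, ⟨hV.not_dom_subset, hW.not_dom_subset⟩, ?_,
      hV.isSkew_sum_indicatorMap, ?_⟩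
    · rw [hV.dom_inter_dom]
      exact hV.dense_core
    · rw [Set.inter_comm]
      exact hW.isSkew_sum_indicatorMap
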